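/- Let $\eta\in\mathbb C$, $M\ge 0$, and let $T^\alpha_{\beta,m}$ ($\alpha,\beta\in\{1,2,3\}$, $0\le m\le M$) be linear operators on a complex vector space $W$ such that the polynomials $T^\alpha_\beta(u)=\sum_{m=0}^M u^mT^\alpha_{\beta,m}$ satisfy, for all $u,v\in\mathbb C$ and all indices, $$(u-v)T^{\alpha_1}_{\beta_1}(u)T^{\alpha_2}_{\beta_2}(v)+\eta T^{\alpha_2}_{\beta_1}(u)T^{\alpha_1}_{\beta_2}(v)=(u-v)T^{\alpha_2}_{\beta_2}(v)T^{\alpha_1}_{\beta_1}(u)+\eta T^{\alpha_2}_{\beta_1}(v)T^{\alpha_1}_{\beta_2}(u).$$ For $\alpha_1<\alpha_2$, $\beta_1<\beta_2$ put $T^{\alpha_1\alpha_2}_{\beta_1\beta_2}(u)=T^{\alpha_2}_{\beta_2}(u)T^{\alpha_1}_{\beta_1}(u+\eta)-T^{\alpha_1}_{\beta_2}(u)T^{\alpha_2}_{\beta_1}(u+\eta)$, and let $U(u)$ be the $3\times3$ matrix with entries $U^\alpha_\beta(u)=(-1)^{\alpha+\beta}T^{\alpha_1\alpha_2}_{\beta_1\beta_2}(u)$,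 where $\{\alpha,\alpha_1,\alpha_2\}=\{\beta,\beta_1,\beta_2\}=\{1,2,3\}$. Let $t_1(u)=\operatorname{tr}T(u)$, $t_2(u)=\operatorname{tr}U(u)$, and assume that the quantum determinant $d(u)=\operatorname{tr}_{123}P^-_{123}\,\overset{1}{T}(u)\overset{2}{T}(u+\eta)\overset{3}{T}(u+2\eta)$, with $P^-_{123}$ the antisymmetrizer of $(\mathbb C^3)^{\otimes3}$ and $\overset{j}{T}$ acting in the $j$-th factor, is a number polynomial. Define $$B(u)=T^2_3(u)U^3_1(u-\eta)-T^1_3(u)U^3_2(u-\eta),\qquad A(u)=-T^2_3(u-\eta)^{-1}U^3_2(u-\eta).$$ Let $x_1,\dots,x_{3M}$ be operator zeros of $B(u)$: commuting operators on $W$ with $B(u)=b_0\prod_{m=1}^{3M}(u-x_m)$ for a number $b_0\neq0$. Call a linear functional $\varphi$ on $W$ an evaluation at $y\in\mathbb C^{3M}$ if $\varphi(x_mf)=y_m\varphi(f)$ for all $m$ and $f$, and let $\operatorname{spec}\{x\}$ be the set of those $y$ at which there is a nonzero evaluation. Assume that vectors of $W$ are separated by these evaluations ($W$ is a space of functions on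 $\operatorname{spec}\{x\}$) and that the spectrum is simple: for every number polynomial $b(u)$, the linear functionals $\varphi$ on $W$ with $\varphi(B(u)f)=b(u)\varphi(f)$ for all $u$ and $f$ form a space of dimension at most $1$. Fix $n\in\{1,\dots,3M\}$. Assume that the numbering of the zeros is consistent with shifts of the $n$-th coordinate: if $y,z\in\operatorname{spec}\{x\}$ and $z$ is a permutation of $y'=(y_1,\dots,y_n-\eta,\dots,y_{3M})$, then $z=y'$. Assume also that for every $y\in\operatorname{spec}\{x\}$ the operators $T^2_3(y_n)$, $T^2_3(y_n-\eta)$, $T^2_3(y_n-2\eta)$ are invertible on $W$. For an operator-valued function $F$ let $[F(u)]_{u=x_n}$ denote the substitution with $x_n$ ordered to the left, i.e. the operator with $\varphi([F(u)]_{u=x_n}f)=\varphi(F(y_n)f)$ for every evaluation $\varphi$ at a point $y$; for $F(u)=\sum_pu^pF_p$ it is $\sum_px_n^pF_p$. Let $X_n=[A(u)]_{u=x_n}$ be an operator on $W$. Then $$X_n^3-X_n^2[t_1(u)]_{u=x_n}+X_n[t_2(u-\eta)]_{u=x_n}-d(x_n-2\eta)=0 .$$ -/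

import Mathlib

open Polynomial

noncomputable section

namespace YangianSL3

variable {W : Type*} [AddCommGroup W] [Module ℂ W]

/-! Operator-valued polynomials in a central variable `u`. -/

/-- The value `F(u)`, at a number `u`, of an operator-valued polynomial. -/
def evalAt (F : (Module.End ℂ W)[X]) (u : ℂ) : Module.End ℂ W :=
  F.eval (algebraMap ℂ (Module.End ℂ W) u)

/-- The operator-valued polynomial `F(u + c)`. -/
def shift (c : ℂ) (F : (Module.End ℂ W)[X]) : (Module.End ℂ W)[X] :=
  F.comp (X + C (algebraMap ℂ (Module.End ℂ W) c))

/-- The substitution `[F(u)]_{u=x} = ∑ₚ xᵖ Fₚ` into `F(u) = ∑ₚ uᵖ Fₚ`, with the powers of the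
operator `x` written to the left of the coefficients. -/
def leftEval (x : Module.End ℂ W) (F : (Module.End ℂ W)[X]) : Module.End ℂ W :=
  F.sum fun p a => x ^ p * a

/-- The polynomial `∑ₘ uᵐ cₘ` of degree at most `M`. -/
def opPoly {M : ℕ} (c : Fin (M + 1) → Module.End ℂ W) : (Module.End ℂ W)[X] :=
  ∑ m : Fin (M + 1), C (c m) * X ^ (m : ℕ)

variable (W) in
/-- A representation on `W` of the algebra with generators `T^α_{β,m}` (`α, β ∈ {1,2,3}`,
`0 ≤ m ≤ M`; here `α, β : Fin 3`) and the quadratic `RTT` relations. -/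
structure Rep (η : ℂ) (M : ℕ) where
  /-- the operators `T^α_{β,m}` -/
  gen : Fin 3 → Fin 3 → Fin (M + 1) → Module.End ℂ W
  rtt : ∀ (u v : ℂ) (a₁ a₂ b₁ b₂ : Fin 3),
    (u - v) • (evalAt (opPoly (gen a₁ b₁)) u * evalAt (opPoly (gen a₂ b₂)) v)
        + η • (evalAt (opPoly (gen a₂ b₁)) u * evalAt (opPoly (gen a₁ b₂)) v)
      = (u - v) • (evalAt (opPoly (gen a₂ b₂)) v * evalAt (opPoly (gen a₁ b₁)) u)
        + η • (evalAt (opPoly (gen a₂ b₁)) v * evalAt (opPoly (gen a₁ b₂)) u)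

namespace Rep

variable {η : ℂ} {M : ℕ} (ρ : Rep W η M)

/-- The matrix `T(u)`; the row is the upper index, the column the lower one. -/
def T : Matrix (Fin 3) (Fin 3) (Module.End ℂ W)[X] :=
  Matrix.of fun a b => opPoly (ρ.gen a b)

/-- The quantum minor
`T^{a₂}_{b₂}(u) T^{a₁}_{b₁}(u+η) - T^{a₁}_{b₂}(u) T^{a₂}_{b₁}(u+η)`
with rows `a₁ < a₂` and columns `b₁ < b₂`. -/
def minor (a₁ a₂ b₁ b₂ : Fin 3) : (Module.End ℂ W)[X] :=
  ρ.T a₂ b₂ * shift η (ρ.T a₁ b₁) - ρ.T a₁ b₂ * shift η (ρ.T a₂ b₁)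

/-- The matrix `U(u)` of quantum minors. -/
def U : Matrix (Fin 3) (Fin 3) (Module.End ℂ W)[X] :=
  !![ ρ.minor 1 2 1 2, -ρ.minor 1 2 0 2,  ρ.minor 1 2 0 1;
     -ρ.minor 0 2 1 2,  ρ.minor 0 2 0 2, -ρ.minor 0 2 0 1;
      ρ.minor 0 1 1 2, -ρ.minor 0 1 0 2,  ρ.minor 0 1 0 1]

/-- `t₁(u) = tr T(u)`. -/
def t₁ : (Module.End ℂ W)[X] := ρ.T.trace

/-- `t₂(u) = tr U(u)`. -/
def t₂ : (Module.End ℂ W)[X] := ρ.U.trace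

/-- The quantum determinant `tr₁₂₃ (P⁻₁₂₃ T₁(u) T₂(u+η) T₃(u+2η))`, where `P⁻₁₂₃` is the
antisymmetrizer `(1/6) ∑_σ sgn(σ) P_σ` of `ℂ³ ⊗ ℂ³ ⊗ ℂ³`, written out in matrix elements. -/
def qdet : (Module.End ℂ W)[X] :=
  (1 / 6 : ℂ) • ∑ σ : Equiv.Perm (Fin 3), ∑ i : Fin 3 → Fin 3,
    (Equiv.Perm.sign σ : ℤ) •
      (ρ.T (i (σ 0)) (i 0) * shift η (ρ.T (i (σ 1)) (i 1)) * shift (2 * η) (ρ.T (i (σ 2)) (i 2)))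

/-- `B(u) = T²₃(u) U³₁(u-η) - T¹₃(u) U³₂(u-η)`. -/
def B : (Module.End ℂ W)[X] :=
  ρ.T 1 2 * shift (-η) (ρ.U 2 0) - ρ.T 0 2 * shift (-η) (ρ.U 2 1)

/-- `A(u) = -T²₃(u-η)⁻¹ U³₂(u-η)`, for a number `u` at which `T²₃(u-η)` is invertible. -/
def A (u : ℂ) : Module.End ℂ W :=
  -(Ring.inverse (evalAt (ρ.T 1 2) (u - η)) * evalAt (ρ.U 2 1) (u - η))

end Rep

/-! Operator zeros and the realization of `W` by functions on their common spectrum. -/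

variable {N : ℕ}

/-- `x₁, …, x_N` are operator zeros of `B(u)` with the (number) leading coefficient `b₀`: they
commute and `B(u) = b₀ ∏ₙ (u - xₙ)`. -/
structure IsOperatorZeros (B : (Module.End ℂ W)[X]) (b₀ : ℂ) (x : Fin N → Module.End ℂ W) :
    Prop where
  commute : ∀ m n, Commute (x m) (x n)
  factor : B = C (algebraMap ℂ (Module.End ℂ W) b₀) * (List.ofFn fun n => X - C (x n)).prod

/-- `φ` is a joint eigenfunctional of the `xₙ`: `φ(xₙ f) = yₙ φ(f)` for all `f`.
When `W` is a space of functions on which the `xₙ` act as multiplication by the coordinates,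
the evaluation `f ↦ f(y)` is such a functional. -/
def IsPointFunctional (x : Fin N → Module.End ℂ W) (y : Fin N → ℂ) (φ : Module.Dual ℂ W) : Prop :=
  ∀ n, φ ∘ₗ x n = y n • φ

/-- The common spectrum of the `xₙ`. -/
def jointSpectrum (x : Fin N → Module.End ℂ W) : Set (Fin N → ℂ) :=
  {y | ∃ φ : Module.Dual ℂ W, φ ≠ 0 ∧ IsPointFunctional x y φ}

/-- `W` is a space of functions on the common spectrum of the `xₙ`: a vector is determined by its
values at the points of the spectrum. -/
def IsFunctionSpace (x : Fin N → Module.End ℂ W) : Prop :=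
  ∀ f : W, (∀ y φ, IsPointFunctional x y φ → φ f = 0) → f = 0

/-- The spectrum of the family `B(u)`, `u ∈ ℂ`, is simple: up to a factor, there is at most one
joint eigenfunctional for each eigenvalue `b(u)`. -/
def HasSimpleSpectrum (B : (Module.End ℂ W)[X]) : Prop :=
  ∀ (b : ℂ[X]) (φ ψ : Module.Dual ℂ W),
    (∀ u, φ ∘ₗ evalAt B u = b.eval u • φ) → (∀ u, ψ ∘ₗ evalAt B u = b.eval u • ψ) →
    φ ≠ 0 → ∃ c : ℂ, ψ = c • φ

/-- The numbering of the zeros is consistent with the shift of the `n`-th coordinate by `-η`: if a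
point `y` of the common spectrum is shifted to `y'`, then no reordering of `y'` other than `y'`
itself lies in the common spectrum. -/
def IsConsistentLabelling (η : ℂ) (x : Fin N → Module.End ℂ W) (n : Fin N) : Prop :=
  ∀ y ∈ jointSpectrum x, ∀ z ∈ jointSpectrum x, ∀ σ : Equiv.Perm (Fin N),
    z ∘ σ = Function.update y n (y n - η) → z = Function.update y n (y n - η)

/-- `Y = [F(u)]_{u=xₙ}` with `xₙ` ordered to the left, for an operator-valued function `F`:
`(Y f)(y) = (F(yₙ) f)(y)` at every point `y` of the common spectrum. This is the Cauchy integral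
`(2πi)⁻¹ ∮ (u - xₙ)⁻¹ F(u) du`, since `((u - xₙ)⁻¹ g)(y) = (u - yₙ)⁻¹ g(y)`. -/
def IsLeftSubst (x : Fin N → Module.End ℂ W) (n : Fin N) (F : ℂ → Module.End ℂ W)
    (Y : Module.End ℂ W) : Prop :=
  ∀ y φ, IsPointFunctional x y φ → φ ∘ₗ Y = φ ∘ₗ F (y n)

/-- For polynomials, the two descriptions of the substitution agree. -/
theorem isLeftSubst_leftEval (x : Fin N → Module.End ℂ W) (n : Fin N)
    (F : (Module.End ℂ W)[X]) : IsLeftSubst x n (evalAt F) (leftEval (x n) F) := by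
  intro y φ h
  have hp : ∀ (p : ℕ) (f : W), φ ((x n ^ p) f) = y n ^ p * φ f := by
    intro p
    induction p with
    | zero => intro f; simp
    | succ p ih =>
      intro f
      have := LinearMap.congr_fun (h n) f
      simp only [LinearMap.comp_apply, LinearMap.smul_apply, smul_eq_mul] at this
      rw [pow_succ, Module.End.mul_apply, ih, this]; ring
  ext f
  simp only [leftEval, evalAt, Polynomial.eval_eq_sum, Polynomial.sum_def, LinearMap.comp_apply,
    LinearMap.sum_apply, map_sum, Module.End.mul_apply, hp]
  refine Finset.sum_congr rfl fun p _ => ?_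
  rw [← map_pow, Module.algebraMap_end_apply, map_smul, map_smul, smul_eq_mul]

/-- A substitution is unique when `W` is a space of functions on the common spectrum. -/
theorem IsLeftSubst.unique {x : Fin N → Module.End ℂ W} (hx : IsFunctionSpace x) {n : Fin N}
    {F : ℂ → Module.End ℂ W} {Y Y' : Module.End ℂ W} (h : IsLeftSubst x n F Y)
    (h' : IsLeftSubst x n F Y') : Y = Y' := by
  ext f
  rw [← sub_eq_zero]
  refine hx _ fun y φ hφ => ?_
  have := LinearMap.congr_fun ((h y φ hφ).trans (h' y φ hφ).symm) f
  simpa [sub_eq_zero] using this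

end YangianSL3

end

/-!
Let `φ` be a joint eigenfunctional of the operator zeros at a point `y`, and let `u = yₙ`, so that
`φ B(u) = 0`. Two facts carry the proof.

*`φ A(u)` is a joint eigenfunctional at `y` with `yₙ` replaced by `yₙ - η`.* The `RTT` relations
give `(v - u) A(u) B(v) = (v - u + η) B(v) A(u) - η B(u) Z` for some `Z` (`Rep.A_mul_B`), so that
`φ A(u)` is an eigenfunctional of all `B(v)`, and its eigenvalue has the zero `u - η` in place of
`u`. As the spectrum is simple and the `xₘ` commute with `B(v)`, it is an eigenfunctional of every
`xₘ`; the eigenvalues are determined by `B(v)` up to a permutation, and the numbering is consistent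
(`Rep.isPointFunctional_comp_A`). Hence
`φ Xₙ³ = φ A(u) A(u - η) A(u - 2η)`, and in the remaining terms of the claim, applied to `φ`, the
functions `t₁`, `t₂` and `d` are all taken at `u - 2η`.

*The characteristic identity holds modulo `B`.* Write `γ(u) = T¹₃(u) T²₃(u)⁻¹`. The covector
`(1, -γ(u), 0)` is an eigenvector of `T(u)` with a shift: multiplied by `T(u)` from the right it is
`A(u) (1, -γ(u - η), 0)`, up to a term `B(u) Z` in the second component
(`Rep.A_eq_val_sub`, `Rep.val_sub_ratio_mul`, `Rep.val_sub_ratio_mul_val`). Expanding the quantum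
determinant with respect to this covector instead of the first row expresses `d(u - 2η)` through
`t₁(u - 2η)`, `t₂(u - 2η)` and the values of `A` (`Rep.qdet_eq`), once the order of the arguments in
the quantum determinant has been reversed (`Rep.qdet_eq_detVal`).

The exchange relation for `A` and `B` rests on the relations between quantum minors and entries.
Those for a single minor come from moving an entry through its two factors (`Rep.minorVal_mul_val`);
in particular a quantum minor commutes with the entries of its own submatrix
(`Rep.commute_minorVal_val`). The relations can be divided by their numerical coefficients only off
a finite set of arguments, and extend to all arguments because everything is polynomial
(`evalHom_eq_zero_of_finite`). Rows and columns are numbered by `0, 1, 2`, so that `T²₃(u)` is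
`ρ.val 1 2 u`.
-/

noncomputable section

namespace YangianSL3

variable {W : Type*} [AddCommGroup W] [Module ℂ W]

/-! ### Evaluation of operator-valued polynomials -/

/-- Evaluation at a number is a ring homomorphism, since numbers are central. -/
def evalHom (u : ℂ) : (Module.End ℂ W)[X] →+* Module.End ℂ W :=
  eval₂RingHom' (RingHom.id _) (algebraMap ℂ (Module.End ℂ W) u)
    fun a => (Algebra.commutes u a).symm

theorem evalAt_eq_evalHom (F : (Module.End ℂ W)[X]) (u : ℂ) : evalAt F u = evalHom u F := rfl

theorem evalHom_C (a : Module.End ℂ W) (u : ℂ) : evalHom u (C a) = a :=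
  eval₂_C _ _

theorem evalHom_X (u : ℂ) :
    evalHom u (X : (Module.End ℂ W)[X]) = algebraMap ℂ (Module.End ℂ W) u :=
  eval₂_X _ _

theorem evalHom_smul (c : ℂ) (F : (Module.End ℂ W)[X]) (u : ℂ) :
    evalHom u (c • F) = c • evalHom u F := by
  have : c • F = C (algebraMap ℂ (Module.End ℂ W) c) * F := by
    ext n : 1
    rw [coeff_smul, coeff_C_mul, Algebra.smul_def]
  rw [this, map_mul, evalHom_C, Algebra.smul_def]

theorem evalHom_shift (c : ℂ) (F : (Module.End ℂ W)[X]) (u : ℂ) :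
    evalHom u (shift c F) = evalHom (u + c) F := by
  unfold shift
  induction F using Polynomial.induction_on' with
  | add p q hp hq => rw [add_comp, map_add, map_add, hp, hq]
  | monomial n a =>
    rw [monomial_comp, ← C_mul_X_pow_eq_monomial]
    simp only [map_mul, map_pow, map_add, evalHom_C, evalHom_X]

theorem evalHom_map (d : ℂ[X]) (u : ℂ) :
    evalHom u (d.map (algebraMap ℂ (Module.End ℂ W))) = d.eval u • 1 := by
  induction d using Polynomial.induction_on' with
  | add p q hp hq => simp only [Polynomial.map_add, map_add, eval_add, add_smul, hp, hq]
  | monomial n a =>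
    rw [← C_mul_X_pow_eq_monomial]
    simp only [Polynomial.map_mul, Polynomial.map_pow, map_X, map_C, map_mul, map_pow, evalHom_C,
      evalHom_X, eval_mul, eval_pow, eval_C, eval_X]
    rw [← map_pow, ← map_mul, Algebra.algebraMap_eq_smul_one]

/-- The matrix elements of an operator-valued polynomial are number polynomials. -/
theorem exists_polynomial_evalHom (F : (Module.End ℂ W)[X]) (φ : Module.Dual ℂ W) (f : W) :
    ∃ p : ℂ[X], ∀ u, p.eval u = φ (evalHom u F f) := by
  induction F using Polynomial.induction_on' with
  | add p q hp hq =>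
    obtain ⟨p', hp⟩ := hp
    obtain ⟨q', hq⟩ := hq
    exact ⟨p' + q', fun u => by simp [hp, hq]⟩
  | monomial n a =>
    refine ⟨C (φ (a f)) * X ^ n, fun u => ?_⟩
    rw [← C_mul_X_pow_eq_monomial, map_mul, map_pow, evalHom_C, evalHom_X, ← map_pow,
      ← Algebra.commutes, ← Algebra.smul_def, eval_mul, eval_C, eval_pow, eval_X,
      LinearMap.smul_apply, map_smul, smul_eq_mul, mul_comm]

/-- Identity principle: if a functional is an eigenfunctional of `F(u)` off a finite set of numbers,
with an eigenvalue polynomial in `u`, then it is one at every number. -/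
theorem comp_evalHom_eq_of_finite (F : (Module.End ℂ W)[X]) (b : ℂ[X]) (φ : Module.Dual ℂ W)
    (S : Set ℂ) (hS : S.Finite)
    (h : ∀ u ∉ S, φ ∘ₗ evalHom u F = b.eval u • φ) (u : ℂ) :
    φ ∘ₗ evalHom u F = b.eval u • φ := by
  ext f
  obtain ⟨p, hp⟩ := exists_polynomial_evalHom F φ f
  have : p = b * C (φ f) := by
    refine Polynomial.eq_of_infinite_eval_eq _ _ (hS.infinite_compl.mono fun v hv => ?_)
    have := LinearMap.congr_fun (h v hv) f
    simpa [hp] using this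
  simp [← hp, this]

/-- Identity principle: an operator-valued polynomial that vanishes off a finite set of numbers
vanishes at every number. -/
theorem evalHom_eq_zero_of_finite (F : (Module.End ℂ W)[X]) (S : Set ℂ) (hS : S.Finite)
    (h : ∀ u ∉ S, evalHom u F = 0) (u : ℂ) : evalHom u F = 0 := by
  ext f
  rw [LinearMap.zero_apply, ← Module.forall_dual_apply_eq_zero_iff ℂ]
  intro φ
  have := comp_evalHom_eq_of_finite F 0 φ S hS (fun v hv => by simp [h v hv]) u
  simpa using LinearMap.congr_fun this f

theorem commute_ringInverse_right {R : Type*} [MonoidWithZero R] {a b : R}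
    (h : Commute a b) : Commute a (Ring.inverse b) := by
  by_cases hb : IsUnit b
  · obtain ⟨b, rfl⟩ := hb
    rw [Ring.inverse_unit]
    exact h.units_inv_right
  · rw [Ring.inverse_non_unit _ hb]
    exact Commute.zero_right a

/-! ### Exchange relations for entries and quantum minors -/

namespace Rep

variable {η : ℂ} {M : ℕ} (ρ : Rep W η M)

/-- The operator `T^a_b(u)` at a number `u`. -/
def val (a b : Fin 3) (u : ℂ) : Module.End ℂ W := evalHom u (ρ.T a b)

/-- The quantum minor with rows `p, q` and columns `i, j` at a number `w`. The rows and columns are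
not assumed to be increasing, nor distinct. -/
def minorVal (p q i j : Fin 3) (w : ℂ) : Module.End ℂ W :=
  ρ.val q j w * ρ.val p i (w + η) - ρ.val p j w * ρ.val q i (w + η)

theorem evalHom_minor (p q i j : Fin 3) (w : ℂ) :
    evalHom w (ρ.minor p q i j) = ρ.minorVal p q i j w := by
  simp only [minor, minorVal, val, map_sub, map_mul, evalHom_shift]

theorem val_rtt (u v : ℂ) (a₁ a₂ b₁ b₂ : Fin 3) :
    (u - v) • (ρ.val a₁ b₁ u * ρ.val a₂ b₂ v) + η • (ρ.val a₂ b₁ u * ρ.val a₁ b₂ v)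
      = (u - v) • (ρ.val a₂ b₂ v * ρ.val a₁ b₁ u) + η • (ρ.val a₂ b₁ v * ρ.val a₁ b₂ u) :=
  ρ.rtt u v a₁ a₂ b₁ b₂

/-- At `η = 0` the relations say that all entries commute, but only at distinct numbers; at equal
numbers this follows by the identity principle. -/
theorem commute_val_of_eta_eq_zero (hη : η = 0) (a₁ a₂ b₁ b₂ : Fin 3) (u v : ℂ) :
    Commute (ρ.val a₁ b₁ u) (ρ.val a₂ b₂ v) := by
  subst hη
  have := evalHom_eq_zero_of_finite
    (C (ρ.val a₁ b₁ u) * ρ.T a₂ b₂ - ρ.T a₂ b₂ * C (ρ.val a₁ b₁ u)) {u} (Set.finite_singleton u)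
    (fun v hv => by
      have h := ρ.val_rtt u v a₁ a₂ b₁ b₂
      rw [zero_smul, zero_smul, add_zero, add_zero] at h
      have huv : u - v ≠ 0 := sub_ne_zero.2 (Ne.symm hv)
      rw [map_sub, map_mul, map_mul, evalHom_C, sub_eq_zero]
      exact smul_right_injective _ huv h) v
  rwa [map_sub, map_mul, map_mul, evalHom_C, sub_eq_zero] at this

/-- The exchange relation at spectral parameters that differ by `η`, where the `R`-matrix
degenerates to an antisymmetrizer: antisymmetrization of the rows turns into antisymmetrization of
the columns. -/
theorem val_mul_val_sub (p q i j : Fin 3) (w : ℂ) :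
    ρ.val p i w * ρ.val q j (w + η) - ρ.val q i w * ρ.val p j (w + η)
      = ρ.val p i (w + η) * ρ.val q j w - ρ.val p j (w + η) * ρ.val q i w := by
  by_cases hη : η = 0
  · have h := fun a₁ a₂ b₁ b₂ => (ρ.commute_val_of_eta_eq_zero hη a₁ a₂ b₁ b₂ w w).eq
    simp only [hη, add_zero]
    rw [h q p i j]
  · apply smul_right_injective _ hη
    have h := ρ.val_rtt w (w + η) q p i j
    simp only [smul_sub]
    rw [sub_add_cancel_left] at h
    linear_combination (norm := module) h

/-- The quantum minor as an antisymmetrized sum over columns, with the arguments in the opposite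
order. -/
theorem minorVal_eq (p q i j : Fin 3) (w : ℂ) :
    ρ.minorVal p q i j w = ρ.val p i (w + η) * ρ.val q j w - ρ.val p j (w + η) * ρ.val q i w := by
  have h₁ := ρ.val_mul_val_sub p q j i w
  unfold minorVal
  linear_combination (norm := module) -h₁

theorem minorVal_swap_rows (p q i j : Fin 3) (w : ℂ) :
    ρ.minorVal q p i j w = -ρ.minorVal p q i j w := by
  simp only [minorVal, neg_sub]

theorem minorVal_swap_cols (p q i j : Fin 3) (w : ℂ) :
    ρ.minorVal p q j i w = -ρ.minorVal p q i j w := by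
  simp only [minorVal_eq, neg_sub]

theorem minorVal_col_self (p q i : Fin 3) (w : ℂ) : ρ.minorVal p q i i w = 0 := by
  rw [minorVal_eq, sub_self]

theorem minorVal_row_self (p i j : Fin 3) (w : ℂ) : ρ.minorVal p p i j w = 0 := by
  rw [minorVal, sub_self]

/-- The exchange relation between a quantum minor and an entry in one of its rows. The entry is
taken from the first row; `minorVal_swap_rows` gives the other case. -/
theorem minorVal_mul_val (p q i j k : Fin 3) {s v : ℂ} (hsv : s ≠ v) :
    (s - v + 2 * η) • (ρ.minorVal p q i j s * ρ.val p k v)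
      = (s - v + η) • (ρ.val p k v * ρ.minorVal p q i j s)
        + η • (ρ.val p i v * ρ.minorVal p q k j s + ρ.val p j v * ρ.minorVal p q i k s) := by
  apply smul_right_injective _ (sub_ne_zero.2 hsv)
  have h₁ := ρ.val_rtt (s + η) v p p i k
  have h₂ := ρ.val_rtt (s + η) v q p i k
  have h₃ := ρ.val_rtt (s + η) v p q i k
  have h₄ := ρ.val_rtt s v q p j k
  have h₅ := ρ.val_rtt s v p p j k
  have h₆ := ρ.val_rtt s v q p j i
  have h₇ := ρ.val_rtt s v p p j i
  have hk : ρ.minorVal p q k i s = -ρ.minorVal p q i k s := ρ.minorVal_swap_cols ..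
  unfold minorVal at hk ⊢
  -- the entry is moved through the second factor of the minor, by `h₁`, `h₂`, `h₃`, and then
  -- through the first one, by `h₄`, …, `h₇`; the coefficients are those of the products
  -- `R₁₀(s - v) R₂₀(s - v + η)` of `R`-matrices, with rows antisymmetrized
  linear_combination (norm := skip)
    (s - v) • (ρ.val q j s * h₁ - ρ.val p j s * h₂) + η • (ρ.val p j s * h₃ - ρ.val p j s * h₂)
    + (s - v + η) • (h₄ * ρ.val p i (s + η) - h₅ * ρ.val q i (s + η))
    + η • (h₆ * ρ.val p k (s + η) - h₇ * ρ.val q k (s + η)) + (η * η) • (ρ.val p j v * hk)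
  simp only [mul_add, add_mul, mul_sub, sub_mul, smul_mul_assoc, mul_smul_comm, mul_assoc,
    mul_neg]
  module

theorem commute_minorVal_val_corner (p q i j : Fin 3) (s v : ℂ) :
    Commute (ρ.minorVal p q i j s) (ρ.val p i v) := by
  have := evalHom_eq_zero_of_finite
    (C (ρ.minorVal p q i j s) * ρ.T p i - ρ.T p i * C (ρ.minorVal p q i j s))
    {s, s + 2 * η} (by simp) (fun v hv => by
      simp only [Set.mem_insert_iff, Set.mem_singleton_iff, not_or] at hv
      have h := ρ.minorVal_mul_val p q i j i (Ne.symm hv.1)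
      have hne : s - v + 2 * η ≠ 0 := fun h => hv.2 (by linear_combination -h)
      rw [map_sub, map_mul, map_mul, evalHom_C, sub_eq_zero]
      apply smul_right_injective _ hne
      rwa [minorVal_col_self, mul_zero, add_zero, ← add_smul, add_assoc, ← two_mul] at h) v
  rwa [map_sub, map_mul, map_mul, evalHom_C, sub_eq_zero] at this

/-- A quantum minor commutes with the entries of the `2 × 2` submatrix whose quantum determinant
it is. -/
theorem commute_minorVal_val {p q i j r k : Fin 3} (hr : r = p ∨ r = q) (hk : k = i ∨ k = j)
    (s v : ℂ) : Commute (ρ.minorVal p q i j s) (ρ.val r k v) := by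
  rcases hr with rfl | rfl <;> rcases hk with rfl | rfl
  · exact ρ.commute_minorVal_val_corner ..
  · rw [← neg_neg (ρ.minorVal _ _ _ _ _), ← minorVal_swap_cols]
    exact (ρ.commute_minorVal_val_corner ..).neg_left
  · rw [← neg_neg (ρ.minorVal _ _ _ _ _), ← minorVal_swap_rows]
    exact (ρ.commute_minorVal_val_corner ..).neg_left
  · rw [← neg_neg (ρ.minorVal _ _ _ _ _), ← minorVal_swap_rows, ← minorVal_swap_cols]
    exact ρ.commute_minorVal_val_corner ..

theorem commute_minorVal (p q i j : Fin 3) (s v : ℂ) :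
    Commute (ρ.minorVal p q i j s) (ρ.minorVal p q i j v) := by
  have h := fun r k (hr : r = p ∨ r = q) (hk : k = i ∨ k = j) v =>
    ρ.commute_minorVal_val hr hk s v
  rw [minorVal.eq_1 ρ p q i j v]
  exact ((h q j (.inr rfl) (.inr rfl) v).mul_right (h p i (.inl rfl) (.inl rfl) _)).sub_right
    ((h p j (.inl rfl) (.inr rfl) v).mul_right (h q i (.inr rfl) (.inl rfl) _))

/-- Entries of `T` commute with themselves at different numbers. -/
theorem commute_val_self (p i : Fin 3) (u v : ℂ) : Commute (ρ.val p i u) (ρ.val p i v) := by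
  have := evalHom_eq_zero_of_finite
    (C (ρ.val p i u) * ρ.T p i - ρ.T p i * C (ρ.val p i u))
    {u + η} (by simp) (fun v hv => by
      have h := ρ.val_rtt u v p p i i
      have hne : u - v + η ≠ 0 := fun h => hv (by
        rw [Set.mem_singleton_iff]; linear_combination -h)
      rw [map_sub, map_mul, map_mul, evalHom_C, sub_eq_zero]
      apply smul_right_injective _ hne
      rwa [← add_smul, ← add_smul] at h) v
  rwa [map_sub, map_mul, map_mul, evalHom_C, sub_eq_zero] at this

/-- The commutator of two quantum minors with the same rows and one column in common, found by moving
one of them through the two factors of the other. The second factor lies in column `j` of the minor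
at `y`, and the extra term of `minorVal_mul_val` there leads to a minor with equal columns. -/
theorem minorVal_commutator (p q i j k : Fin 3) {s y : ℂ} (h : s ≠ y + η) :
    (s - y) • (ρ.minorVal p q i k s * ρ.minorVal p q j k y
        - ρ.minorVal p q j k y * ρ.minorVal p q i k s)
      = η • (ρ.minorVal p q i k y * ρ.minorVal p q j k s
        - ρ.minorVal p q i k s * ρ.minorVal p q j k y) := by
  have hp := ρ.minorVal_mul_val p q i k j h
  have hq := ρ.minorVal_mul_val q p i k j h
  rw [minorVal_swap_rows, minorVal_swap_rows _ p q j k, minorVal_swap_rows _ p q i j] at hq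
  have cq := (ρ.commute_minorVal_val (p := p) (q := q) (i := i) (j := k) (.inr rfl) (.inr rfl)
    s y : Commute _ (ρ.val q k y)).eq
  have cp := (ρ.commute_minorVal_val (p := p) (q := q) (i := i) (j := k) (.inl rfl) (.inr rfl)
    s y : Commute _ (ρ.val p k y)).eq
  have h0 : ρ.minorVal p q k k y = 0 := ρ.minorVal_col_self ..
  have hE : ρ.minorVal p q j k y
      = ρ.val q k y * ρ.val p j (y + η) - ρ.val p k y * ρ.val q j (y + η) := rfl
  have hD : ρ.minorVal p q i k y
      = ρ.val q k y * ρ.val p i (y + η) - ρ.val p k y * ρ.val q i (y + η) := rfl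
  have h0' : ρ.val q k y * ρ.val p k (y + η) - ρ.val p k y * ρ.val q k (y + η) = 0 := h0
  rw [hD, hE]
  linear_combination (norm := skip) ρ.val q k y * hp + ρ.val p k y * hq
    + (s - y + η) • (cq * ρ.val p j (y + η) - cp * ρ.val q j (y + η))
    + η • (h0' * ρ.minorVal p q i j s)
  simp only [mul_add, mul_sub, sub_mul, mul_smul_comm, mul_assoc,
    mul_neg, neg_mul, zero_mul]
  module

/-- The exchange relation for two quantum minors with the same rows and one column in common, in the
form with the other order of the minors on the right-hand side. -/
theorem minorVal_mul_minorVal (p q i j k : Fin 3) {s y : ℂ} (h₁ : s ≠ y) (h₂ : s ≠ y + η)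
    (h₃ : y ≠ s + η) :
    (y - s) • (ρ.minorVal p q i k s * ρ.minorVal p q j k y
        - ρ.minorVal p q j k y * ρ.minorVal p q i k s)
      = η • (ρ.minorVal p q j k y * ρ.minorVal p q i k s
        - ρ.minorVal p q j k s * ρ.minorVal p q i k y) := by
  have h := ρ.minorVal_commutator p q i j k h₂
  have h' := ρ.minorVal_commutator p q i j k h₃
  -- the two relations have opposite right-hand sides, so the two commutators agree
  have h'' : ρ.minorVal p q i k y * ρ.minorVal p q j k s
        - ρ.minorVal p q j k s * ρ.minorVal p q i k y = ρ.minorVal p q i k s * ρ.minorVal p q j k y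
        - ρ.minorVal p q j k y * ρ.minorVal p q i k s := by
    apply smul_right_injective _ (sub_ne_zero.2 h₁)
    linear_combination (norm := module) -h - h'
  linear_combination (norm := module) -h - η • h''

/-! ### The exchange relation between `A` and `B` -/

/-- `B` and `A` only involve the quantum minors with rows `0, 1`. -/
theorem evalHom_B (u : ℂ) : evalHom u ρ.B
    = ρ.val 1 2 u * ρ.minorVal 0 1 1 2 (u - η) + ρ.val 0 2 u * ρ.minorVal 0 1 0 2 (u - η) := by
  simp [B, U, evalHom_shift, evalHom_minor, val, sub_eq_add_neg]

theorem A_eq (u : ℂ) : ρ.A u = Ring.inverse (ρ.val 1 2 (u - η)) * ρ.minorVal 0 1 0 2 (u - η) := by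
  simp [A, U, evalAt_eq_evalHom, evalHom_minor, val]

theorem val_mul_val_shift (u : ℂ) :
    ρ.val 0 2 (u - η) * ρ.val 1 2 u = ρ.val 1 2 (u - η) * ρ.val 0 2 u := by
  have h := ρ.val_mul_val_sub 0 1 2 2 (u - η)
  rwa [sub_self, sub_add_cancel, sub_eq_zero] at h

/-- The ratio of `val 0 2` and `val 1 2` with the denominator on the right, and its form with the
denominator on the left at a number shifted by `η`. -/
theorem ratio_eq {u : ℂ} (hu : IsUnit (ρ.val 1 2 u)) (hu' : IsUnit (ρ.val 1 2 (u - η))) :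
    ρ.val 0 2 u * Ring.inverse (ρ.val 1 2 u)
      = Ring.inverse (ρ.val 1 2 (u - η)) * ρ.val 0 2 (u - η) := by
  apply hu'.mul_left_cancel
  apply hu.mul_right_cancel
  simp only [mul_assoc, Ring.inverse_mul_cancel _ hu, mul_one]
  rw [← mul_assoc _ (Ring.inverse _), Ring.mul_inverse_cancel _ hu', one_mul, val_mul_val_shift]

/-- Moving `A(u)` through `B(v)` shifts a zero of `B`, up to a multiple of `B(u)`. -/
theorem A_mul_B {u v : ℂ} (hu : IsUnit (ρ.val 1 2 u)) (hu' : IsUnit (ρ.val 1 2 (u - η)))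
    (h₁ : u ≠ v) (h₂ : u ≠ v + η) (h₃ : v ≠ u + η) :
    (v - u) • (ρ.A u * evalHom v ρ.B) = (v - u + η) • (evalHom v ρ.B * ρ.A u)
      - η • (evalHom u ρ.B * (Ring.inverse (ρ.val 1 2 u) * ρ.val 1 2 v
        * Ring.inverse (ρ.val 1 2 (u - η)) * ρ.minorVal 0 1 0 2 (v - η))) := by
  have hs : v - u + η ≠ 0 := fun h => h₂ (by linear_combination -h)
  have hDE := ρ.minorVal_mul_minorVal 0 1 0 1 2 (s := u - η) (y := v - η) (by simpa using h₁)
    (fun h => h₂ (by linear_combination h)) (fun h => h₃ (by linear_combination h))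
  rw [sub_sub_sub_cancel_right] at hDE
  have h := ρ.val_rtt v (u - η) 0 1 2 2
  have h' := ρ.val_rtt (u - η) v 0 1 2 2
  rw [A_eq, evalHom_B, evalHom_B]
  have cD : ∀ r k s v, r = 1 ∨ r = 0 → k = 2 →
      Commute (ρ.minorVal 0 1 0 2 s) (ρ.val r k v) := fun r k s v hr hk =>
    ρ.commute_minorVal_val hr.symm (.inr hk) s v
  have cE : ∀ s v, Commute (ρ.minorVal 0 1 1 2 s) (ρ.val 1 2 v) := fun s v =>
    ρ.commute_minorVal_val (.inr rfl) (.inr rfl) s v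
  have c₁ := cD 1 2 (u - η) v (.inl rfl) rfl
  have c₂ := cD 0 2 (u - η) v (.inr rfl) rfl
  have c₃ := commute_ringInverse_right (cD 1 2 (u - η) u (.inl rfl) rfl)
  have c₄ := commute_ringInverse_right (cD 1 2 (v - η) (u - η) (.inl rfl) rfl)
  have c₅ := commute_ringInverse_right (cD 1 2 (u - η) (u - η) (.inl rfl) rfl)
  have c₆ := ρ.commute_minorVal 0 1 0 2 (u - η) (v - η)
  have e₁ := cE (u - η) v
  have e₂ := commute_ringInverse_right (cE (u - η) u)
  have e₃ := commute_ringInverse_right (cE (u - η) (u - η))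
  have e₄ := commute_ringInverse_right (cE (v - η) (u - η))
  have r₁ := (commute_ringInverse_right (ρ.commute_val_self 1 2 v (u - η))).symm
  have hpP := Ring.mul_inverse_cancel _ hu'
  have hPp := Ring.inverse_mul_cancel _ hu'
  have hgG := Ring.mul_inverse_cancel _ hu
  have hratio := ρ.ratio_eq hu hu'
  -- from here on, an identity between letters: `p`, `r`, `g` are the values of `T²₃` at `u - η`, `v`,
  -- `u`, and `as`, `av`, `a` those of `T¹₃`; `P` and `G` are the inverses of `p` and `g`; `D` and `E`
  -- are the two minors in `B`, at `u - η` (letter `s`) and `v - η` (letter `y`)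
  generalize ρ.minorVal 0 1 0 2 (u - η) = Ds at *
  generalize ρ.minorVal 0 1 0 2 (v - η) = Dy at *
  generalize ρ.minorVal 0 1 1 2 (u - η) = Es at *
  generalize ρ.minorVal 0 1 1 2 (v - η) = Ey at *
  generalize Ring.inverse (ρ.val 1 2 (u - η)) = P at *
  generalize Ring.inverse (ρ.val 1 2 u) = G at *
  generalize ρ.val 1 2 (u - η) = p at *
  generalize ρ.val 0 2 (u - η) = as at *
  generalize ρ.val 1 2 v = r at *
  generalize ρ.val 0 2 v = av at *
  generalize ρ.val 1 2 u = g at *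
  generalize ρ.val 0 2 u = a at *
  -- each product is brought to a form with the minors on the right
  have t₁ : P * Ds * (r * Ey + av * Dy) = r * P * (Ds * Ey) + P * av * (Dy * Ds) := by
    simp only [mul_add, mul_assoc, c₁.left_comm, c₂.left_comm, c₆.eq, r₁.left_comm]
  have t₂ : (r * Ey + av * Dy) * (P * Ds) = r * P * (Ey * Ds) + av * P * (Dy * Ds) := by
    simp only [add_mul, mul_assoc, e₄.left_comm, c₄.left_comm]
  have t₃ : (g * Es + a * Ds) * (G * r * P * Dy)
      = r * P * (Es * Dy) + P * as * r * P * (Dy * Ds) := by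
    rw [← hratio]
    simp only [add_mul, mul_assoc, c₁.left_comm, c₃.left_comm, c₅.left_comm, c₆.eq, e₁.left_comm,
      e₂.left_comm, e₃.left_comm]
    simp only [← mul_assoc, hgG, one_mul]
  -- the remaining relation between entries; after multiplication by `p` from both sides it is a
  -- combination of the two exchange relations of `T¹₃` and `T²₃` at `v` and `u - η`
  have hav : (v - u) • (P * av) = (v - u + η) • (av * P) - η • (P * as * r * P) := by
    apply hu'.mul_left_cancel
    apply hu'.mul_right_cancel
    simp only [mul_sub, sub_mul, mul_smul_comm, smul_mul_assoc]
    have z₁ : p * (P * av) * p = av * p := by rw [← mul_assoc, hpP, one_mul]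
    have z₂ : p * (av * P) * p = p * av := by rw [mul_assoc, mul_assoc, hPp, mul_one]
    have z₃ : p * (P * as * r * P) * p = as * r := by
      rw [mul_assoc, mul_assoc, hPp, mul_one, mul_assoc, ← mul_assoc, hpP, one_mul]
    rw [z₁, z₂, z₃]
    have hS : av * p - p * av = as * r - r * as := by
      apply smul_right_injective _ hs
      linear_combination (norm := module) h + h'
    linear_combination (norm := module) h - η • hS
  rw [t₁, t₂, t₃]
  have hav' := congrArg (· * (Dy * Ds)) hav
  simp only [sub_mul, smul_mul_assoc] at hav'
  have hDE' := congrArg (r * P * ·) hDE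
  simp only [mul_sub, mul_smul_comm] at hDE'
  linear_combination (norm := module) hav' + hDE'

end Rep

/-! ### Doubly antisymmetrized sums -/

section AltSum

open Equiv

variable {R : Type*} [AddCommGroup R]

/-- The sum of `f σ τ` over pairs of permutations of the three tensor factors (one for the rows, one
for the columns), with both signs. -/
def altSum (f : Perm (Fin 3) → Perm (Fin 3) → R) : R :=
  ∑ σ, ∑ τ, ((Perm.sign σ : ℤ) * (Perm.sign τ : ℤ)) • f σ τ

theorem altSum_add (f g : Perm (Fin 3) → Perm (Fin 3) → R) :
    altSum (fun σ τ => f σ τ + g σ τ) = altSum f + altSum g := by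
  simp only [altSum, smul_add, Finset.sum_add_distrib]

theorem altSum_smul [Module ℂ R] (c : ℂ) (f : Perm (Fin 3) → Perm (Fin 3) → R) :
    altSum (fun σ τ => c • f σ τ) = c • altSum f := by
  simp only [altSum, Finset.smul_sum, smul_comm c]

theorem sum_sign_smul_mul_swap {i j : Fin 3} (hij : i ≠ j) (f : Perm (Fin 3) → R) :
    ∑ σ, (Perm.sign σ : ℤ) • f (σ * swap i j) = -∑ σ, (Perm.sign σ : ℤ) • f σ := by
  rw [← Finset.sum_neg_distrib]
  refine Fintype.sum_equiv (Equiv.mulRight (swap i j)) _ _ fun σ => ?_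
  simp [Perm.sign_swap hij]

theorem altSum_swap_left {i j : Fin 3} (hij : i ≠ j) (f : Perm (Fin 3) → Perm (Fin 3) → R) :
    altSum (fun σ τ => f (σ * swap i j) τ) = -altSum f := by
  simp only [altSum, mul_smul, ← Finset.smul_sum]
  exact sum_sign_smul_mul_swap hij fun σ => ∑ τ, (Perm.sign τ : ℤ) • f σ τ

theorem altSum_swap_right {i j : Fin 3} (hij : i ≠ j) (f : Perm (Fin 3) → Perm (Fin 3) → R) :
    altSum (fun σ τ => f σ (τ * swap i j)) = -altSum f := by
  simp only [altSum, mul_smul, ← Finset.smul_sum, sum_sign_smul_mul_swap hij (f _), smul_neg,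
    Finset.sum_neg_distrib]

/-- An exchange relation in two of the tensor factors becomes an equality under the doubly
antisymmetrized sum: there a swap of the rows or of the columns is multiplication by `-1`, so both
sides of the relation are multiplied by the same number `c + 1`. -/
theorem altSum_eq_of_exchange [Module ℂ R] {i j : Fin 3} (hij : i ≠ j) {c : ℂ} (hc : c + 1 ≠ 0)
    {f g : Perm (Fin 3) → Perm (Fin 3) → R}
    (h : ∀ σ τ, c • f σ τ - f (σ * swap i j) τ
      = c • g (σ * swap i j) (τ * swap i j) - g (σ * swap i j) τ) :
    altSum f = altSum g := by
  have h₁ : altSum (fun σ τ => c • f σ τ + (-1 : ℂ) • f (σ * swap i j) τ)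
      = altSum fun σ τ => c • g (σ * swap i j) (τ * swap i j) + (-1 : ℂ) • g (σ * swap i j) τ := by
    congr 1
    funext σ τ
    linear_combination (norm := module) h σ τ
  simp only [altSum_add, altSum_smul, altSum_swap_left hij f, altSum_swap_left hij g,
    altSum_swap_left hij fun σ τ => g σ (τ * swap i j), altSum_swap_right hij g] at h₁
  apply smul_right_injective _ hc
  linear_combination (norm := module) h₁

theorem sum_perm_three (f : Perm (Fin 3) → R) :
    ∑ σ, f σ = f 1 + f (swap 0 1) + f (swap 0 2) + f (swap 1 2) + f (swap 0 1 * swap 1 2)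
      + f (swap 0 1 * swap 0 2) := by
  have : (Finset.univ : Finset (Perm (Fin 3))) = {1, swap 0 1, swap 0 2, swap 1 2,
      swap 0 1 * swap 1 2, swap 0 1 * swap 0 2} := by decide
  rw [this]
  repeat rw [Finset.sum_insert (by decide)]
  rw [Finset.sum_singleton]
  abel

theorem sum_sign_smul_three (f : Fin 3 → Fin 3 → Fin 3 → R) :
    ∑ σ : Perm (Fin 3), (Perm.sign σ : ℤ) • f (σ 0) (σ 1) (σ 2)
      = f 0 1 2 - f 1 0 2 - f 2 1 0 - f 0 2 1 + f 1 2 0 + f 2 0 1 := by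
  have h₁ : (swap 0 1 * swap 1 2 : Perm (Fin 3)) 0 = 1 := by decide
  have h₂ : (swap 0 1 * swap 1 2 : Perm (Fin 3)) 1 = 2 := by decide
  have h₃ : (swap 0 1 * swap 1 2 : Perm (Fin 3)) 2 = 0 := by decide
  have h₄ : (swap 0 1 * swap 0 2 : Perm (Fin 3)) 0 = 2 := by decide
  have h₅ : (swap 0 1 * swap 0 2 : Perm (Fin 3)) 1 = 0 := by decide
  have h₆ : (swap 0 1 * swap 0 2 : Perm (Fin 3)) 2 = 1 := by decide
  have h₇ : (swap 0 1 : Perm (Fin 3)) 2 = 2 := by decide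
  have h₈ : (swap 0 2 : Perm (Fin 3)) 1 = 1 := by decide
  have h₉ : (swap 1 2 : Perm (Fin 3)) 0 = 0 := by decide
  rw [sum_perm_three]
  simp only [h₁, h₂, h₃, h₄, h₅, h₆, h₇, h₈, h₉, swap_apply_left, swap_apply_right, Perm.one_apply,
    Perm.sign_mul, Perm.sign_swap (show (0 : Fin 3) ≠ 1 by decide),
    Perm.sign_swap (show (0 : Fin 3) ≠ 2 by decide),
    Perm.sign_swap (show (1 : Fin 3) ≠ 2 by decide), Perm.sign_one, Units.val_one, Units.val_neg,
    one_smul, neg_smul, mul_neg, neg_neg, mul_one]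
  abel

/-- A signed sum over the row indices `i ∘ σ`, for all column indices `i`, only involves the
permutations `i`. -/
theorem sum_sign_smul_comp_eq_altSum (F : (Fin 3 → Fin 3) → (Fin 3 → Fin 3) → R) :
    ∑ σ : Perm (Fin 3), ∑ i : Fin 3 → Fin 3, (Perm.sign σ : ℤ) • F (i ∘ σ) i
      = altSum fun σ τ => F σ τ := by
  rw [Finset.sum_comm, altSum]
  conv_rhs => rw [Finset.sum_comm]
  symm
  refine Fintype.sum_of_injective (fun τ : Perm (Fin 3) => (τ : Fin 3 → Fin 3))
    DFunLike.coe_injective _ _ (fun i hi => ?_) fun τ => ?_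
  · have hi' : ¬ Function.Injective i := fun h =>
      hi ⟨Equiv.ofBijective i (Finite.injective_iff_bijective.1 h), rfl⟩
    obtain ⟨a, b, hab, hne⟩ := Function.not_injective_iff.1 hi'
    -- multiplying `σ` on the left by the swap of two numbers with equal images under `i` changes
    -- the sign of a summand and nothing else
    refine Finset.sum_involution (fun σ _ => swap a b * σ) (fun σ _ => ?_) (fun σ _ _ h => ?_)
      (fun σ _ => Finset.mem_univ _) fun σ _ => ?_
    · have h : i ∘ ⇑(swap a b * σ) = i ∘ σ := by
        funext k
        rw [Function.comp_apply, Perm.mul_apply, swap_apply_def, Function.comp_apply]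
        split_ifs with h₁ h₂
        · rw [h₁, hab]
        · rw [h₂, hab]
        · rfl
      rw [h, Perm.sign_mul, Perm.sign_swap hne]
      simp
    · exact hne (swap_eq_one_iff.1 (mul_eq_right.1 h))
    · rw [← mul_assoc, swap_mul_self, one_mul]
  · refine Fintype.sum_equiv (Equiv.mulLeft τ⁻¹) _ _ fun σ => ?_
    simp [← Perm.coe_mul, mul_comm]

end AltSum

/-! ### The quantum determinant -/

namespace Rep

variable {η : ℂ} {M : ℕ} (ρ : Rep W η M)

section

open Equiv

/-- The quantum determinant of the rows `p, q, r`, expanded along the row `p`. -/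
def detVal (p q r : Fin 3) (w : ℂ) : Module.End ℂ W :=
  ρ.val p 0 (w + 2 * η) * ρ.minorVal q r 1 2 w - ρ.val p 1 (w + 2 * η) * ρ.minorVal q r 0 2 w
    + ρ.val p 2 (w + 2 * η) * ρ.minorVal q r 0 1 w

/-- The expansion along the row `r`. -/
theorem detVal_eq (p q r : Fin 3) (w : ℂ) : ρ.detVal p q r w
    = ρ.minorVal p q 0 1 (w + η) * ρ.val r 2 w - ρ.minorVal p q 0 2 (w + η) * ρ.val r 1 w
      + ρ.minorVal p q 1 2 (w + η) * ρ.val r 0 w := by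
  have h : w + η + η = w + 2 * η := by ring
  simp only [detVal, minorVal_eq, h]
  noncomm_ring

theorem detVal_swap_right (p q r : Fin 3) (w : ℂ) : ρ.detVal p r q w = -ρ.detVal p q r w := by
  simp only [detVal, ρ.minorVal_swap_rows q r]
  noncomm_ring

theorem detVal_swap_left (p q r : Fin 3) (w : ℂ) : ρ.detVal q p r w = -ρ.detVal p q r w := by
  simp only [detVal_eq, ρ.minorVal_swap_rows p q]
  noncomm_ring

theorem detVal_self (p r : Fin 3) (w : ℂ) : ρ.detVal p p r w = 0 := by
  simp only [detVal_eq, minorVal_row_self, zero_mul, sub_zero, add_zero]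

/-- The exchange relation at spectral parameters that differ by `2η`. -/
theorem val_exchange_two (p q i j : Fin 3) (w : ℂ) :
    (2 : ℂ) • (ρ.val p i w * ρ.val q j (w + 2 * η)) - ρ.val q i w * ρ.val p j (w + 2 * η)
      = (2 : ℂ) • (ρ.val q j (w + 2 * η) * ρ.val p i w)
        - ρ.val q i (w + 2 * η) * ρ.val p j w := by
  by_cases hη : η = 0
  · have h := (ρ.commute_val_of_eta_eq_zero hη p q i j w w).eq
    simp only [hη, mul_zero, add_zero, h]
  · apply smul_right_injective _ hη
    have h := ρ.val_rtt w (w + 2 * η) p q i j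
    rw [sub_add_cancel_left] at h
    linear_combination (norm := module) -h

/-- Under the doubly antisymmetrized sum, the first two factors can trade their arguments
`w` and `w + η`. -/
theorem altSum_val_exchange (Z : Fin 3 → Fin 3 → Module.End ℂ W) (w : ℂ) :
    (altSum fun σ τ => ρ.val (σ 0) (τ 0) w * ρ.val (σ 1) (τ 1) (w + η) * Z (σ 2) (τ 2))
      = altSum fun σ τ => ρ.val (σ 0) (τ 0) (w + η) * ρ.val (σ 1) (τ 1) w * Z (σ 2) (τ 2) := by
  refine altSum_eq_of_exchange (i := 0) (j := 1) (c := 1) (by decide) (by norm_num) fun σ τ => ?_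
  have h0 : ∀ σ : Perm (Fin 3), (σ * swap 0 1 : Perm (Fin 3)) 2 = σ 2 := fun σ => by
    rw [Perm.mul_apply, swap_apply_of_ne_of_ne (by decide) (by decide)]
  simp only [h0, one_smul]
  simp only [Perm.mul_apply, swap_apply_left, swap_apply_right, ← sub_mul]
  exact congrArg (· * Z (σ 2) (τ 2)) (ρ.minorVal_eq (σ 1) (σ 0) (τ 1) (τ 0) w)

/-- The quantum determinant is the column determinant of `T`, with the arguments in the order
`w + 2η, w + η, w` opposite to that of its definition. -/
theorem qdet_eq_detVal (w : ℂ) : evalHom w ρ.qdet = ρ.detVal 0 1 2 w := by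
  have h₁ : evalHom w ρ.qdet = (1 / 6 : ℂ) • altSum fun σ τ =>
      ρ.val (σ 0) (τ 0) w * ρ.val (σ 1) (τ 1) (w + η) * ρ.val (σ 2) (τ 2) (w + 2 * η) := by
    rw [← sum_sign_smul_comp_eq_altSum fun p i =>
      ρ.val (p 0) (i 0) w * ρ.val (p 1) (i 1) (w + η) * ρ.val (p 2) (i 2) (w + 2 * η)]
    simp only [qdet, evalHom_smul, map_sum, map_zsmul, map_mul, evalHom_shift, val,
      Function.comp_apply]
  -- the antisymmetrizer reverses the order of the factors, by three exchanges
  have h₂ : (altSum fun σ τ =>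
        ρ.val (σ 0) (τ 0) w * ρ.val (σ 1) (τ 1) (w + η) * ρ.val (σ 2) (τ 2) (w + 2 * η))
      = altSum fun σ τ =>
        ρ.val (σ 0) (τ 0) (w + η) * ρ.val (σ 1) (τ 1) w * ρ.val (σ 2) (τ 2) (w + 2 * η) :=
    ρ.altSum_val_exchange (fun p i => ρ.val p i (w + 2 * η)) w
  have h₃ : (altSum fun σ τ =>
        ρ.val (σ 0) (τ 0) (w + η) * ρ.val (σ 1) (τ 1) w * ρ.val (σ 2) (τ 2) (w + 2 * η))
      = altSum fun σ τ =>
        ρ.val (σ 0) (τ 0) (w + η) * ρ.val (σ 1) (τ 1) (w + 2 * η) * ρ.val (σ 2) (τ 2) w := by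
    refine altSum_eq_of_exchange (i := 1) (j := 2) (c := 2) (by decide) (by norm_num) fun σ τ => ?_
    have h := ρ.val_exchange_two (σ 1) (σ 2) (τ 1) (τ 2) w
    have h0 : ∀ σ : Perm (Fin 3), (σ * swap 1 2 : Perm (Fin 3)) 0 = σ 0 := fun σ => by
      rw [Perm.mul_apply, swap_apply_of_ne_of_ne (by decide) (by decide)]
    simp only [h0]
    simp only [Perm.mul_apply, swap_apply_left, swap_apply_right, mul_assoc]
    have h' := congrArg (ρ.val (σ 0) (τ 0) (w + η) * ·) h
    simpa only [mul_sub, mul_smul_comm] using h'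
  have h₄ : (altSum fun σ τ =>
        ρ.val (σ 0) (τ 0) (w + η) * ρ.val (σ 1) (τ 1) (w + 2 * η) * ρ.val (σ 2) (τ 2) w)
      = altSum fun σ τ =>
        ρ.val (σ 0) (τ 0) (w + 2 * η) * ρ.val (σ 1) (τ 1) (w + η) * ρ.val (σ 2) (τ 2) w := by
    have h := ρ.altSum_val_exchange (fun p i => ρ.val p i w) (w + η)
    rwa [show w + η + η = w + 2 * η by ring] at h
  have h₅ : ∀ p q r, ∑ τ : Perm (Fin 3), (Perm.sign τ : ℤ) •
        (ρ.val p (τ 0) (w + 2 * η) * ρ.val q (τ 1) (w + η) * ρ.val r (τ 2) w)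
      = ρ.detVal p q r w := fun p q r => by
    rw [sum_sign_smul_three fun i j k =>
      ρ.val p i (w + 2 * η) * ρ.val q j (w + η) * ρ.val r k w]
    simp only [detVal, minorVal_eq]
    noncomm_ring
  rw [h₁, h₂, h₃, h₄]
  simp only [altSum, mul_smul, ← Finset.smul_sum, h₅]
  rw [sum_sign_smul_three fun p q r => ρ.detVal p q r w]
  have e₁ := ρ.detVal_swap_left 0 1 2 w
  have e₂ := ρ.detVal_swap_right 0 1 2 w
  have e₃ := ρ.detVal_swap_right 1 0 2 w
  have e₄ := ρ.detVal_swap_left 0 2 1 w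
  have e₅ := ρ.detVal_swap_right 2 0 1 w
  rw [e₅, e₄, e₃, e₂, e₁]
  module

end

/-! ### The characteristic identity modulo `B` -/

/-- The ratio `T¹₃(u) T²₃(u)⁻¹`. The covector `(1, -ratio u, 0)` annihilates the third column of
`T(u)`; applied to an eigenfunctional of `B` with a zero at `u`, it is a quantum analogue of an
eigenvector of `T(u)`. -/
def ratio (u : ℂ) : Module.End ℂ W := ρ.val 0 2 u * Ring.inverse (ρ.val 1 2 u)

/-- `A(u)` is the first component of the covector `(1, -ratio u, 0)` times `T(u)`. -/
theorem A_eq_val_sub {u : ℂ} (hu : IsUnit (ρ.val 1 2 u)) (hu' : IsUnit (ρ.val 1 2 (u - η))) :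
    ρ.A u = ρ.val 0 0 u - ρ.ratio u * ρ.val 1 0 u := by
  rw [A_eq, ratio, ρ.ratio_eq hu hu', minorVal, sub_add_cancel, mul_sub, ← mul_assoc,
    Ring.inverse_mul_cancel _ hu', one_mul, mul_assoc]

/-- The second component of the covector `(1, -ratio u, 0)` times `T(u)` is `-A(u) ratio (u - η)`,
up to a multiple of `B(u)`. -/
theorem val_sub_ratio_mul {u : ℂ} (hu : IsUnit (ρ.val 1 2 u)) (hu' : IsUnit (ρ.val 1 2 (u - η))) :
    ρ.val 0 1 u - ρ.ratio u * ρ.val 1 1 u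
      = evalHom u ρ.B * (Ring.inverse (ρ.val 1 2 u) * Ring.inverse (ρ.val 1 2 (u - η)))
        - ρ.A u * ρ.ratio (u - η) := by
  have hE : ρ.val 0 1 u - ρ.ratio u * ρ.val 1 1 u
      = Ring.inverse (ρ.val 1 2 (u - η)) * ρ.minorVal 0 1 1 2 (u - η) := by
    rw [ratio, ρ.ratio_eq hu hu', minorVal, sub_add_cancel, mul_sub, ← mul_assoc,
      Ring.inverse_mul_cancel _ hu', one_mul, mul_assoc]
  have c₁ := commute_ringInverse_right
    (ρ.commute_minorVal_val (p := 0) (q := 1) (i := 1) (j := 2) (r := 1) (k := 2)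
    (.inr rfl) (.inr rfl) (u - η) u)
  have c₂ := commute_ringInverse_right
    (ρ.commute_minorVal_val (p := 0) (q := 1) (i := 1) (j := 2) (r := 1) (k := 2)
    (.inr rfl) (.inr rfl) (u - η) (u - η))
  have c₃ := commute_ringInverse_right
    (ρ.commute_minorVal_val (p := 0) (q := 1) (i := 0) (j := 2) (r := 1) (k := 2)
    (.inr rfl) (.inr rfl) (u - η) u)
  have c₄ := ρ.commute_minorVal_val (p := 0) (q := 1) (i := 0) (j := 2) (r := 0) (k := 2)
    (.inl rfl) (.inr rfl) (u - η) (u - η)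
  have hr := ρ.ratio_eq hu hu'
  have hg := Ring.mul_inverse_cancel _ hu
  rw [hE, evalHom_B, A_eq, ratio, add_mul]
  simp only [mul_assoc, c₁.left_comm, c₂.eq, c₃.left_comm]
  simp only [← mul_assoc, hg, one_mul, hr]
  rw [mul_assoc _ (ρ.val 0 2 (u - η)), ← c₄.eq]
  noncomm_ring

theorem val_sub_ratio_mul_val {u : ℂ} (hu : IsUnit (ρ.val 1 2 u)) :
    ρ.val 0 2 u - ρ.ratio u * ρ.val 1 2 u = 0 := by
  rw [ratio, mul_assoc, Ring.inverse_mul_cancel _ hu, mul_one, sub_self]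

/-- The quantum determinant as `A(w + 2η)` times a combination of quantum minors, up to a multiple
of `B(w + 2η)`. -/
theorem qdet_eq_A_mul {w : ℂ} (h₁ : IsUnit (ρ.val 1 2 (w + η)))
    (h₂ : IsUnit (ρ.val 1 2 (w + 2 * η))) : ∃ Z, evalHom w ρ.qdet
      = ρ.A (w + 2 * η) * (ρ.minorVal 1 2 1 2 w + ρ.ratio (w + η) * ρ.minorVal 1 2 0 2 w)
        + evalHom (w + 2 * η) ρ.B * Z := by
  have hw : w + 2 * η - η = w + η := by ring
  have h₁' : IsUnit (ρ.val 1 2 (w + 2 * η - η)) := by rwa [hw]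
  have e₀ := ρ.A_eq_val_sub h₂ h₁'
  have e₁ := ρ.val_sub_ratio_mul h₂ h₁'
  have e₂ := ρ.val_sub_ratio_mul_val h₂
  -- the determinant with the rows `1, 1, 2`, for the second component of the covector
  have e₃ := ρ.detVal_self 1 2 w
  rw [hw] at e₁
  rw [detVal] at e₃
  rw [qdet_eq_detVal, detVal]
  refine ⟨-(Ring.inverse (ρ.val 1 2 (w + 2 * η)) * Ring.inverse (ρ.val 1 2 (w + η)) *
    ρ.minorVal 1 2 0 2 w), ?_⟩
  linear_combination (norm := skip) ρ.ratio (w + 2 * η) * e₃ - e₀ * ρ.minorVal 1 2 1 2 w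
    - e₁ * ρ.minorVal 1 2 0 2 w + e₂ * ρ.minorVal 1 2 0 1 w
  noncomm_ring

theorem evalHom_t₁ (w : ℂ) : evalHom w ρ.t₁ = ρ.val 0 0 w + ρ.val 1 1 w + ρ.val 2 2 w := by
  simp [t₁, Matrix.trace_fin_three, val]

theorem evalHom_t₂ (w : ℂ) : evalHom w ρ.t₂
    = ρ.minorVal 1 2 1 2 w + ρ.minorVal 0 2 0 2 w + ρ.minorVal 0 1 0 1 w := by
  simp [t₂, Matrix.trace_fin_three, U, evalHom_minor]

/-- The minors that complete those of `qdet_eq_A_mul` to `t₂`, as `A(w + η)` times a combination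
of entries of `T(w)`, up to a multiple of `B(w + η)`. -/
theorem minors_eq_A_mul {w : ℂ} (h₀ : IsUnit (ρ.val 1 2 w)) (h₁ : IsUnit (ρ.val 1 2 (w + η))) :
    ∃ Z, ρ.minorVal 0 2 0 2 w + ρ.minorVal 0 1 0 1 w - ρ.ratio (w + η) * ρ.minorVal 1 2 0 2 w
      = ρ.A (w + η) * (ρ.val 1 1 w + ρ.val 2 2 w + ρ.ratio w * ρ.val 1 0 w)
        + evalHom (w + η) ρ.B * Z := by
  have hw : w + η - η = w := by ring
  have h₀' : IsUnit (ρ.val 1 2 (w + η - η)) := by rwa [hw]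
  have e₀ := ρ.A_eq_val_sub h₁ h₀'
  have e₁ := ρ.val_sub_ratio_mul h₁ h₀'
  have e₂ := ρ.val_sub_ratio_mul_val h₁
  -- with equal rows, two entries in the coefficient of `ratio (w + η)` cancel
  have e₃ := ρ.minorVal_row_self 1 0 1 w
  rw [hw] at e₁
  rw [minorVal_eq] at e₃
  simp only [minorVal_eq]
  refine ⟨-(Ring.inverse (ρ.val 1 2 (w + η)) * Ring.inverse (ρ.val 1 2 w) * ρ.val 1 0 w), ?_⟩
  linear_combination (norm := skip) -(e₀ * (ρ.val 1 1 w + ρ.val 2 2 w)) - e₁ * ρ.val 1 0 w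
    - e₂ * ρ.val 2 0 w + ρ.ratio (w + η) * e₃
  noncomm_ring

/-- The quantum characteristic identity, up to terms that begin with `B(w + 2η)` or with
`A(w + 2η) B(w + η)`. The cubic term contains `A(w)` in the form of `A_eq_val_sub`, which makes sense
without an inverse at `w - η`. -/
theorem qdet_eq {w : ℂ} (h₀ : IsUnit (ρ.val 1 2 w)) (h₁ : IsUnit (ρ.val 1 2 (w + η)))
    (h₂ : IsUnit (ρ.val 1 2 (w + 2 * η))) : ∃ Z Z', evalHom w ρ.qdet
      = ρ.A (w + 2 * η) * evalHom w ρ.t₂ - ρ.A (w + 2 * η) * ρ.A (w + η) * evalHom w ρ.t₁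
        + ρ.A (w + 2 * η) * ρ.A (w + η) * (ρ.val 0 0 w - ρ.ratio w * ρ.val 1 0 w)
        + evalHom (w + 2 * η) ρ.B * Z + ρ.A (w + 2 * η) * evalHom (w + η) ρ.B * Z' := by
  obtain ⟨Z, hZ⟩ := ρ.qdet_eq_A_mul h₁ h₂
  obtain ⟨Z', hZ'⟩ := ρ.minors_eq_A_mul h₀ h₁
  refine ⟨Z, -Z', ?_⟩
  rw [evalHom_t₁, evalHom_t₂, hZ]
  linear_combination (norm := skip) -(ρ.A (w + 2 * η) * hZ')
  noncomm_ring

end Rep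

/-! ### Joint eigenfunctionals and their shifts -/

variable {N : ℕ}

theorem comp_prod_map_eq_smul {ι : Type*} {φ : Module.Dual ℂ W} (l : List ι)
    (Z : ι → Module.End ℂ W) (c : ι → ℂ) (h : ∀ i, φ ∘ₗ Z i = c i • φ) :
    φ ∘ₗ (l.map Z).prod = (l.map c).prod • φ := by
  induction l with
  | nil => simp [Module.End.one_eq_id]
  | cons a l ih =>
    rw [List.map_cons, List.prod_cons, List.map_cons, List.prod_cons, Module.End.mul_eq_comp,
      ← LinearMap.comp_assoc, h, LinearMap.smul_comp, ih, smul_smul]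

theorem comp_aeval_eq_smul {φ : Module.Dual ℂ W} {Z : Module.End ℂ W} {c : ℂ}
    (h : φ ∘ₗ Z = c • φ) (d : ℂ[X]) : φ ∘ₗ aeval Z d = d.eval c • φ := by
  induction d using Polynomial.induction_on with
  | C a => ext f; simp [Module.algebraMap_end_apply]
  | add p q hp hq => rw [map_add, LinearMap.comp_add, hp, hq, eval_add, add_smul]
  | monomial n a ih =>
    rw [pow_succ, ← mul_assoc, map_mul, aeval_X, Module.End.mul_eq_comp, ← LinearMap.comp_assoc,
      ih, LinearMap.smul_comp, h, smul_smul, eval_mul (q := X), eval_X]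

/-- The eigenvalue of `b₀ ∏ₘ (u - xₘ)` on the joint eigenfunctionals at `y`. -/
def eigenvalue (b₀ : ℂ) (y : Fin N → ℂ) : ℂ[X] := C b₀ * ∏ m, (X - C (y m))

theorem eval_eigenvalue (b₀ : ℂ) (y : Fin N → ℂ) (v : ℂ) :
    (eigenvalue b₀ y).eval v = b₀ * ∏ m, (v - y m) := by
  simp [eigenvalue, eval_prod]

theorem eval_eigenvalue_update (b₀ : ℂ) (y : Fin N → ℂ) (n : Fin N) (z v : ℂ) :
    (v - y n) * (eigenvalue b₀ (Function.update y n z)).eval v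
      = (v - z) * (eigenvalue b₀ y).eval v := by
  rw [eval_eigenvalue, eval_eigenvalue, ← Finset.mul_prod_erase _ _ (Finset.mem_univ n),
    ← Finset.mul_prod_erase _ (fun m => v - y m) (Finset.mem_univ n), Function.update_self]
  rw [Finset.prod_congr rfl fun m hm => by
    rw [Function.update_of_ne (Finset.ne_of_mem_erase hm)]]
  ring

/-- The eigenvalue of `B` determines the point up to the numbering of its coordinates. -/
theorem exists_perm_of_eigenvalue_eq {b₀ : ℂ} (hb₀ : b₀ ≠ 0) {y z : Fin N → ℂ}
    (h : eigenvalue b₀ z = eigenvalue b₀ y) : ∃ σ : Equiv.Perm (Fin N), z ∘ σ = y := by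
  have hr : ∀ y : Fin N → ℂ, (eigenvalue b₀ y).roots = Finset.univ.val.map y := fun y => by
    have := roots_multiset_prod_X_sub_C (Finset.univ.val.map y)
    rw [Multiset.map_map] at this
    rwa [eigenvalue, roots_C_mul _ hb₀]
  have h' := congrArg roots h
  rw [hr, hr] at h'
  -- equal multisets of values: the fibres of `y` and `z` have the same cardinalities
  have e : ∀ c, Nonempty ({m // y m = c} ≃ {m // z m = c}) := fun c => by
    refine ⟨Fintype.equivOfCardEq ?_⟩
    have hc := congrArg (Multiset.count c) h'
    rw [Multiset.count_map, Multiset.count_map] at hc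
    rw [Fintype.card_subtype, Fintype.card_subtype]
    simp only [Finset.card_def, Finset.filter_val, eq_comm (b := c)]
    exact hc.symm
  exact ⟨Equiv.ofFiberEquiv fun c => (e c).some, funext fun m => Equiv.ofFiberEquiv_map _ m⟩

theorem IsOperatorZeros.comp_evalHom {B : (Module.End ℂ W)[X]} {b₀ : ℂ}
    {x : Fin N → Module.End ℂ W} (hx : IsOperatorZeros B b₀ x) {y : Fin N → ℂ}
    {φ : Module.Dual ℂ W} (hφ : IsPointFunctional x y φ) (v : ℂ) :
    φ ∘ₗ evalHom v B = (eigenvalue b₀ y).eval v • φ := by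
  have h := comp_prod_map_eq_smul (φ := φ) (List.finRange N)
    (fun m => algebraMap ℂ (Module.End ℂ W) v - x m) (fun m => v - y m) (fun m => by
      rw [LinearMap.comp_sub, hφ m, sub_smul]
      ext f
      simp [Module.algebraMap_end_apply])
  rw [hx.factor, map_mul, evalHom_C, ← Algebra.smul_def, map_list_prod, List.map_ofFn,
    List.ofFn_eq_map, LinearMap.comp_smul, eval_eigenvalue, Fin.prod_univ_def, mul_smul, ← h]
  simp only [Function.comp_def, map_sub, evalHom_X, evalHom_C]

theorem IsOperatorZeros.commute_evalHom {B : (Module.End ℂ W)[X]} {b₀ : ℂ}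
    {x : Fin N → Module.End ℂ W} (hx : IsOperatorZeros B b₀ x) (m : Fin N) (v : ℂ) :
    Commute (x m) (evalHom v B) := by
  rw [hx.factor, map_mul, evalHom_C, map_list_prod, List.map_ofFn]
  refine (Algebra.commute_algebraMap_right b₀ (x m)).mul_right
    (Commute.list_prod_right _ _ fun z hz => ?_)
  obtain ⟨k, rfl⟩ := List.mem_ofFn.1 hz
  rw [Function.comp_apply, map_sub, evalHom_X, evalHom_C]
  exact (Algebra.commute_algebraMap_right v (x m)).sub_right (hx.commute m k)

/-- A simple spectrum and a consistent numbering turn an eigenfunctional of `B(u)` into a joint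
eigenfunctional of the operator zeros. -/
theorem isPointFunctional_of_comp_evalHom {η : ℂ} {B : (Module.End ℂ W)[X]} {b₀ : ℂ}
    (hb₀ : b₀ ≠ 0) {x : Fin N → Module.End ℂ W} (hx : IsOperatorZeros B b₀ x)
    (hsimple : HasSimpleSpectrum B) {n : Fin N} (hlabel : IsConsistentLabelling η x n)
    {y : Fin N → ℂ} (hy : y ∈ jointSpectrum x) {φ : Module.Dual ℂ W}
    (hφ : ∀ v, φ ∘ₗ evalHom v B
      = (eigenvalue b₀ (Function.update y n (y n - η))).eval v • φ) :
    IsPointFunctional x (Function.update y n (y n - η)) φ := by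
  by_cases h0 : φ = 0
  · intro m
    rw [h0, LinearMap.zero_comp, smul_zero]
  -- `φ ∘ xₘ` is an eigenfunctional of `B` with the same eigenvalue, so a multiple of `φ`
  have hc : ∀ m, ∃ c : ℂ, φ ∘ₗ x m = c • φ := fun m =>
    hsimple _ φ (φ ∘ₗ x m) hφ (fun v => by
      have hcomm : x m ∘ₗ evalHom v B = evalHom v B ∘ₗ x m := (hx.commute_evalHom m v).eq
      rw [evalAt_eq_evalHom, LinearMap.comp_assoc, hcomm, ← LinearMap.comp_assoc, hφ,
        LinearMap.smul_comp]) h0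
  choose z hz using hc
  have hzb : eigenvalue b₀ z = eigenvalue b₀ (Function.update y n (y n - η)) := by
    refine Polynomial.funext fun v => smul_left_injective ℂ h0 ?_
    exact (hx.comp_evalHom hz v).symm.trans (hφ v)
  obtain ⟨σ, hσ⟩ := exists_perm_of_eigenvalue_eq hb₀ hzb
  -- `z` lies in the spectrum and is a permutation of the shifted point
  rw [← hlabel y hy z ⟨φ, h0, hz⟩ σ hσ]
  exact hz

/-- Composition with `A(yₙ)` shifts the `n`-th coordinate of a point functional by `-η`. -/
theorem Rep.isPointFunctional_comp_A {η : ℂ} {M : ℕ} (ρ : Rep W η M) {b₀ : ℂ}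
    (hb₀ : b₀ ≠ 0) {x : Fin N → Module.End ℂ W} (hx : IsOperatorZeros ρ.B b₀ x)
    (hsimple : HasSimpleSpectrum ρ.B) {n : Fin N} (hlabel : IsConsistentLabelling η x n)
    {y : Fin N → ℂ} (hu : IsUnit (ρ.val 1 2 (y n))) (hu' : IsUnit (ρ.val 1 2 (y n - η)))
    (hy : y ∈ jointSpectrum x) {φ : Module.Dual ℂ W} (hφ : IsPointFunctional x y φ) :
    IsPointFunctional x (Function.update y n (y n - η)) (φ ∘ₗ ρ.A (y n)) := by
  refine isPointFunctional_of_comp_evalHom hb₀ hx hsimple hlabel hy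
    (comp_evalHom_eq_of_finite _ _ _ {y n, y n - η, y n + η} (by simp) fun v hv => ?_)
  simp only [Set.mem_insert_iff, Set.mem_singleton_iff, not_or] at hv
  obtain ⟨h₁, h₂, h₃⟩ := hv
  have hAB := ρ.A_mul_B hu hu' (Ne.symm h₁) (fun h => h₂ (by linear_combination -h)) h₃
  have hB := hx.comp_evalHom hφ
  have hBy : φ ∘ₗ evalHom (y n) ρ.B = 0 := by
    rw [hB, eval_eigenvalue, Finset.prod_eq_zero (Finset.mem_univ n) (sub_self _), mul_zero,
      zero_smul]
  have h := congrArg (φ ∘ₗ ·) hAB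
  simp only [LinearMap.comp_sub, LinearMap.comp_smul, Module.End.mul_eq_comp,
    ← LinearMap.comp_assoc, hBy, LinearMap.zero_comp, smul_zero, sub_zero, hB,
    LinearMap.smul_comp] at h
  apply smul_right_injective _ (sub_ne_zero.2 h₁)
  have he := eval_eigenvalue_update b₀ y n (y n - η) v
  simp only [h, smul_smul, he]
  congr 1
  ring

end YangianSL3

end

open YangianSL3 in
theorem proposition3 {W : Type*} [AddCommGroup W] [Module ℂ W] (η : ℂ) (M : ℕ)
    (ρ : YangianSL3.Rep W η M)
    -- the quantum determinant is a number polynomial `d(u)`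
    (d : Polynomial ℂ) (hd : ρ.qdet = d.map (algebraMap ℂ (Module.End ℂ W)))
    -- `x₁, …, x_{3M}` are the operator zeros of `B(u)`
    (b₀ : ℂ) (hb₀ : b₀ ≠ 0) (x : Fin (3 * M) → Module.End ℂ W)
    (hx : YangianSL3.IsOperatorZeros ρ.B b₀ x)
    -- the spectrum is simple and `W` is a space of functions on it
    (hsimple : YangianSL3.HasSimpleSpectrum ρ.B) (hfun : YangianSL3.IsFunctionSpace x)
    (n : Fin (3 * M)) (hlabel : YangianSL3.IsConsistentLabelling η x n)
    -- the inverses of `T²₃` are regular at the spectrum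
    (hreg : ∀ y ∈ YangianSL3.jointSpectrum x,
      IsUnit (YangianSL3.evalAt (ρ.T 1 2) (y n)) ∧
      IsUnit (YangianSL3.evalAt (ρ.T 1 2) (y n - η)) ∧
      IsUnit (YangianSL3.evalAt (ρ.T 1 2) (y n - 2 * η)))
    -- `Xₙ = [A(u)]_{u = xₙ}`
    (Xn : Module.End ℂ W) (hX : YangianSL3.IsLeftSubst x n ρ.A Xn) :
    Xn ^ 3 - Xn ^ 2 * YangianSL3.leftEval (x n) ρ.t₁
      + Xn * YangianSL3.leftEval (x n) (YangianSL3.shift (-η) ρ.t₂)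
      - Polynomial.aeval (x n - algebraMap ℂ (Module.End ℂ W) (2 * η)) d = 0 := by
  have hreg' : ∀ y φ, φ ≠ 0 → IsPointFunctional x y φ → IsUnit (ρ.val 1 2 (y n)) ∧
      IsUnit (ρ.val 1 2 (y n - η)) ∧ IsUnit (ρ.val 1 2 (y n - 2 * η)) :=
    fun y φ h0 hφ => hreg y ⟨φ, h0, hφ⟩
  have hstep : ∀ y φ, IsPointFunctional x y φ →
      IsPointFunctional x (Function.update y n (y n - η)) (φ ∘ₗ Xn) := fun y φ hφ => by
    by_cases h0 : φ = 0
    · intro m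
      rw [h0, LinearMap.zero_comp, LinearMap.zero_comp, smul_zero]
    · rw [hX y φ hφ]
      exact ρ.isPointFunctional_comp_A hb₀ hx hsimple hlabel (hreg' y φ h0 hφ).1
        (hreg' y φ h0 hφ).2.1 ⟨φ, h0, hφ⟩ hφ
  have hzero : ∀ y φ, IsPointFunctional x y φ → φ ∘ₗ evalHom (y n) ρ.B = 0 := fun y φ hφ => by
    rw [hx.comp_evalHom hφ, eval_eigenvalue, Finset.prod_eq_zero (Finset.mem_univ n) (sub_self _),
      mul_zero, zero_smul]
  ext f
  refine hfun _ fun y φ hφ => ?_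
  by_cases h0 : φ = 0
  · rw [h0, LinearMap.zero_apply]
  obtain ⟨w, hw⟩ : ∃ w, y n = w + 2 * η := ⟨y n - 2 * η, by ring⟩
  have hφ₁ := hstep y φ hφ
  have hφ₂ := hstep _ _ hφ₁
  have hA₁ := hX y φ hφ
  have hA₂ := hX _ _ hφ₁
  have hA₃ := hX _ _ hφ₂
  have hB₀ := hzero _ _ hφ
  have hB₁ := hzero _ _ hφ₁
  have ht₁ := isLeftSubst_leftEval x n ρ.t₁ _ _ hφ₂
  have ht₂ := isLeftSubst_leftEval x n (shift (-η) ρ.t₂) _ _ hφ₁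
  obtain ⟨u₀, u₁, u₂⟩ := hreg' y φ h0 hφ
  have e₁ : w + 2 * η - η = w + η := by ring
  have e₂ : w + η - η = w := by ring
  have e₃ : w + η + -η = w := by ring
  have e₄ : w + 2 * η - 2 * η = w := by ring
  simp only [Function.update_self, hw, e₁, e₂, e₃, e₄, evalAt_eq_evalHom, evalHom_shift]
    at hA₁ hA₂ hA₃ hB₀ hB₁ ht₁ ht₂ u₀ u₁ u₂
  -- `T²₃(w - η)` need not be invertible if the doubly shifted functional vanishes
  have hA₃' : φ ∘ₗ Xn ∘ₗ Xn ∘ₗ Xn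
      = φ ∘ₗ Xn ∘ₗ Xn ∘ₗ (ρ.val 0 0 w - ρ.ratio w * ρ.val 1 0 w) := by
    simp only [← LinearMap.comp_assoc]
    by_cases h2 : (φ ∘ₗ Xn) ∘ₗ Xn = 0
    · rw [h2, LinearMap.zero_comp, LinearMap.zero_comp]
    · have hu := (hreg' _ _ h2 hφ₂).2.1
      simp only [Function.update_self, hw, e₁, e₂] at hu
      rw [hA₃, ρ.A_eq_val_sub u₂ hu]
  have hd' : φ ∘ₗ aeval (x n - algebraMap ℂ (Module.End ℂ W) (2 * η)) d = d.eval w • φ := by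
    refine comp_aeval_eq_smul ?_ d
    rw [LinearMap.comp_sub, hφ n, hw]
    ext f
    simp [Module.algebraMap_end_apply]
    ring
  -- the characteristic identity applied to `φ`, where the terms with `B` vanish
  obtain ⟨Z, Z', hq⟩ := ρ.qdet_eq u₂ u₁ u₀
  rw [hd, evalHom_map] at hq
  have hφq := congrArg (φ ∘ₗ ·) hq
  simp only [LinearMap.comp_add, LinearMap.comp_sub, LinearMap.comp_smul, Module.End.mul_eq_comp,
    ← LinearMap.comp_assoc, ← hA₁, ← hA₂, hB₀, hB₁, LinearMap.zero_comp, add_zero,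
    Module.End.one_eq_id, LinearMap.comp_id] at hφq
  simp only [LinearMap.comp_sub, ← LinearMap.comp_assoc] at hA₃'
  have key : φ ∘ₗ (Xn ^ 3 - Xn ^ 2 * leftEval (x n) ρ.t₁
      + Xn * leftEval (x n) (shift (-η) ρ.t₂)
      - aeval (x n - algebraMap ℂ (Module.End ℂ W) (2 * η)) d) = 0 := by
    simp only [pow_succ, pow_zero, one_mul, LinearMap.comp_add, LinearMap.comp_sub,
      Module.End.mul_eq_comp, ← LinearMap.comp_assoc, ht₁, ht₂, hd', hA₃', hφq]
    abel
  exact LinearMap.congr_fun key f
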